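/- Let $\mathcal X$ be a measurable space and let $\alpha\in[0,1]$. A (symmetric) regression algorithm $\mathcal A$ maps every data set $((x_1,y_1),\dots,(x_k,y_k))\in(\mathcal X\times\mathbb R)^k$, $k\ge 0$, to a function $\mathcal X\to\mathbb R$ that does not depend on the order of the data points, and whose value is jointly measurable in the data set and the argument. Let $P$ be a probability distribution on $\mathcal X\times\mathbb R$ and $(X_1,Y_1),(X_2,Y_2),\dots$ i.i.d. from $P$; write $\mathcal D_n=((X_i,Y_i))_{i\le n}$ and $\widehat\mu_n=\mathcal A(\mathcal D_n)$. For $n\ge1$ put $$\beta^{\mathrm{in}}_{1,n}(\mathcal A,P)=\mathbb E\big|\widehat\mu_n(X_1)-\widehat\mu_{n+1}(X_1)\big|\in[0,\infty],\qquad \beta^{*,\mathrm{in}}_{1,n}(\mathcal A,P)=\sup_{n'\ge n}\beta^{\mathrm{in}}_{1,n'}(\mathcal A,P).$$ For $\gamma>0$ the $\gamma$-inflated full conformal prediction set at $x\in\mathcal X$ is $$\widehat C_n^{\gamma\text{-CP}}(x)=\Big\{y\in\mathbb R:\ |y-\widehat\mu^{y}(x)|\le \mathrm{Quantile}\big(\{|Y_i-\widehat\mu^{y}(X_i)|\}_{i\le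 n};(1-\alpha)(1+1/n)\big)+\gamma\Big\},$$ where $\widehat\mu^{y}=\mathcal A\big((X_1,Y_1),\dots,(X_n,Y_n),(x,y)\big)$ and $\mathrm{Quantile}(\{z_i\}_{i\le n};\tau)=\inf\{t\in\mathbb R:\#\{i:z_i\le t\}\ge\tau n\}\in[-\infty,\infty]$. Its training-conditional miscoverage rate is $$\alpha_P^{\gamma\text{-CP}}(\mathcal D_n)=\mathbb P\big\{Y_{n+1}\notin\widehat C_n^{\gamma\text{-CP}}(X_{n+1})\,\big|\,\mathcal D_n\big\}.$$ Fix any sequences $b_n,\gamma_n>0$ with $b_n/\gamma_n\to0$. Then there is a sequence $\epsilon_n\to0$, given explicitly by $$\epsilon_n=\frac{3}{\sqrt[4]{4\min\{n,m_n\}}}+2\sqrt[3]{\frac{2m_nb_n}{\gamma_n}},\qquad m_n=\big\lceil (b_n/\gamma_n)^{-1/2}\big\rceil,$$ such that $$\lim_{n\to\infty}\ \sup_{\substack{\mathcal A,\,P\ \text{s.t.}\\ \beta^{*,\mathrm{in}}_{1,n+1}(\mathcal A,P)\le b_n}}\ \mathbb P\big\{\alpha_P^{\gamma_n\text{-CP}}(\mathcal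 D_n)\ge\alpha+\epsilon_n\big\}=0 .$$ -/

import Mathlib

open MeasureTheory Filter Topology
open scoped ENNReal

noncomputable section

/-- A (deterministic, symmetric) regression algorithm on the feature space `X`: it takes a data set
of any size and returns a fitted regression function `X → ℝ`. The fitted value is measurable
jointly in the data set and the feature (so every fitted function is measurable, and the
probabilities and expectations below make sense). -/
structure RegressionAlgorithm (X : Type*) [MeasurableSpace X] where
  /-- `fit n D` is the regression function fitted to the data set `D` of size `n`. -/
  fit : (n : ℕ) → (Fin n → X × ℝ) → X → ℝ
  /-- the fitted function does not depend on the order of the data points -/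
  symmetric : ∀ (n : ℕ) (π : Equiv.Perm (Fin n)) (D : Fin n → X × ℝ), fit n (D ∘ π) = fit n D
  /-- joint measurability -/
  measurable_fit : ∀ n : ℕ, Measurable (fun p : (Fin n → X × ℝ) × X => fit n p.1 p.2)

/-- The law of `n` i.i.d. draws from `P`. -/
def iidLaw {Z : Type*} [MeasurableSpace Z] (P : ProbabilityMeasure Z) (n : ℕ) :
    Measure (Fin n → Z) :=
  Measure.pi (fun _ : Fin n => (P : Measure Z))

/-- In-sample `m`-stability at sample size `n ≥ 1`: the expectation of `|μ̂ₙ(X₁) - μ̂ₙ₊ₘ(X₁)|`, where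
`μ̂ₙ₊ₘ` is fitted to `n + m` i.i.d. draws from `P` and `μ̂ₙ` to the first `n` of them, and `X₁` is the
feature of the first draw. It is a value in `[0, ∞]`. -/
def inSampleStability {X : Type*} [MeasurableSpace X] (A : RegressionAlgorithm X)
    (P : ProbabilityMeasure (X × ℝ)) (m n : ℕ) (hn : 0 < n) : ℝ≥0∞ :=
  ∫⁻ D : Fin (n + m) → X × ℝ,
    ENNReal.ofReal |A.fit n (fun i => D (Fin.castAdd m i)) (D (Fin.castAdd m ⟨0, hn⟩)).1
      - A.fit (n + m) D (D (Fin.castAdd m ⟨0, hn⟩)).1| ∂(iidLaw P (n + m))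

/-- The supremum over `n' ≥ n` of the in-sample `1`-stability at sample size `n'`. -/
def supInSampleStability {X : Type*} [MeasurableSpace X] (A : RegressionAlgorithm X)
    (P : ProbabilityMeasure (X × ℝ)) (n : ℕ) (hn : 0 < n) : ℝ≥0∞ :=
  ⨆ (n' : ℕ) (h : n ≤ n'), inSampleStability A P 1 n' (hn.trans_le h)

/-- The `τ`-quantile of the empirical distribution of `z₁, …, zₙ`: the infimum of all real `t` for
which at least `τ * n` of the values are at most `t`. It is `+∞` for `τ > 1` and `-∞` for `τ ≤ 0`. -/
def empiricalQuantile {n : ℕ} (z : Fin n → ℝ) (τ : ℝ) : EReal :=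
  sInf ((fun t : ℝ => (t : EReal)) ''
    {t : ℝ | τ * (n : ℝ) ≤ ((Finset.univ.filter (fun i : Fin n => z i ≤ t)).card : ℝ)})

/-- The model `μ̂^y` fitted to the training data together with the hypothesized test point
`(x, y)`. -/
def augmentedFit {X : Type*} [MeasurableSpace X] (A : RegressionAlgorithm X) {n : ℕ}
    (D : Fin n → X × ℝ) (x : X) (y : ℝ) : X → ℝ :=
  A.fit (n + 1) (Fin.snoc D (x, y))

/-- The `γ`-inflated full conformal prediction set at the test feature `x`, at nominal miscoverage
level `α`. -/
def conformalSet {X : Type*} [MeasurableSpace X] (A : RegressionAlgorithm X) (α γ : ℝ) {n : ℕ}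
    (D : Fin n → X × ℝ) (x : X) : Set ℝ :=
  {y : ℝ | ((|y - augmentedFit A D x y x| : ℝ) : EReal) ≤
    empiricalQuantile (fun i : Fin n => |(D i).2 - augmentedFit A D x y (D i).1|)
      ((1 - α) * (1 + 1 / (n : ℝ))) + (γ : EReal)}

/-- The training-conditional miscoverage rate of the `γ`-inflated full conformal set: the
probability, over a fresh test point from `P` with the training data `D` held fixed, that the
response is not in the prediction set. -/
def conformalMiscoverage {X : Type*} [MeasurableSpace X] (A : RegressionAlgorithm X)
    (P : ProbabilityMeasure (X × ℝ)) (α γ : ℝ) {n : ℕ} (D : Fin n → X × ℝ) : ℝ :=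
  (P : Measure (X × ℝ)).real {p : X × ℝ | p.2 ∉ conformalSet A α γ D p.1}

/-- The integer `m = ⌈(b / γ) ^ (-1/2)⌉`. -/
def slackSize (b γ : ℝ) : ℕ := ⌈(b / γ) ^ (-(1 / 2) : ℝ)⌉₊

/-- The slack `3 / (4 min {n, m}) ^ (1/4) + 2 (2 m b / γ) ^ (1/3)` with `m = ⌈(b / γ) ^ (-1/2)⌉`. -/
def coverageSlack (n : ℕ) (b γ : ℝ) : ℝ :=
  3 / (4 * (min n (slackSize b γ) : ℕ) : ℝ) ^ (1 / 4 : ℝ)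
    + 2 * (2 * (slackSize b γ : ℝ) * b / γ) ^ (1 / 3 : ℝ)

end

/-! Add `m` auxiliary test points to the `n` training points and compare two kinds of residuals:
those of one model fitted to all `n + m` points, and, for each test point `j`, those of the
conformal model fitted to the training points and `j` alone. The former are exchangeable by symmetry
of the algorithm; the latter decide whether `j` is covered.

In-sample stability adds up over the `m - 1` extra points, so by Markov a given residual differs
between the two models by more than `γ / 2` with probability at most `s = 2 m b / γ`. Except for a
fraction `δ` of bad test points, a miscovered `j` therefore has a full-model residual exceeding at
least a fraction `1 - α - δ` of the training ones: the inflation `γ` absorbs the perturbation of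
both residuals compared. Exchangeability (`measureReal_card_rank_ge_le`) makes it unlikely that a
fraction `α + δ + 2h` of the test points ranks so high. Given the training data the test points are
independent, so the miscovered fraction is unlikely to fall below the true rate by `h`
(`prod_pi_card_filter_mem_le`).

Together these give slack `3h + 2δ` in `iidLaw_conformalMiscoverage_ge_le`. Taking `δ = s ^ (1/3)`
and `h = (4 min {n, m}) ^ (-1/4)` makes slack and failure probability vanish, uniformly in the
algorithm and the distribution. -/

/-! ### Exchangeability and concentration. -/

/-- A subfamily of an i.i.d. family is i.i.d. This serves both for permuting a sample and for
restricting to a subsample. -/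
theorem measurePreserving_pi_comp_injective {Z ι κ : Type*} [MeasurableSpace Z] [Fintype ι]
    [Fintype κ] (P : Measure Z) [IsProbabilityMeasure P] {e : κ → ι} (he : Function.Injective e) :
    MeasurePreserving (fun (ω : ι → Z) k => ω (e k)) (Measure.pi fun _ => P)
      (Measure.pi fun _ => P) := by
  refine ⟨by fun_prop, ?_⟩
  have h := (ProbabilityTheory.iIndepFun_pi (ι := ι) (μ := fun _ => P) (X := fun _ (z : Z) => z)
    (fun _ => aemeasurable_id)).precomp he
  replace h : ProbabilityTheory.iIndepFun (fun (k : κ) (ω : ι → Z) => ω (e k))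
      (Measure.pi fun _ => P) := h
  rw [ProbabilityTheory.iIndepFun_iff_map_fun_eq_pi_map
    (fun k => (measurable_pi_apply (e k)).aemeasurable)] at h
  rw [h]
  congr 1
  funext k
  exact (measurePreserving_eval (fun _ => P) (e k)).map_eq

/-- Sampling without replacement: a sum over `T` of bounded, centred, permutation-equivariant
functions of an exchangeable vector has second moment at most `#T`. -/
theorem integral_sq_sum_le_card_of_exchangeable {ι V : Type*} [Fintype ι] [DecidableEq ι]
    [MeasurableSpace V] {ν : Measure (ι → V)} [IsProbabilityMeasure ν]
    (hν : ∀ σ : Equiv.Perm ι, MeasurePreserving (fun v : ι → V => v ∘ σ) ν ν)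
    {a : (ι → V) → ι → ℝ} (ha : ∀ i, Measurable fun v => a v i)
    (hσ : ∀ (σ : Equiv.Perm ι) v i, a (v ∘ σ) i = a v (σ i))
    (hbd : ∀ v i, |a v i| ≤ 1) (h0 : ∀ v, ∑ i, a v i = 0) (T : Finset ι) :
    ∫ v, (∑ i ∈ T, a v i) ^ 2 ∂ν ≤ T.card := by
  have hint : ∀ i j, Integrable (fun v => a v i * a v j) ν := fun i j => by
    refine Integrable.of_bound ((ha i).mul (ha j)).aestronglyMeasurable 1 (ae_of_all _ fun v => ?_)
    rw [Real.norm_eq_abs, abs_mul]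
    exact mul_le_one₀ (hbd v i) (abs_nonneg _) (hbd v j)
  -- The transposition of `j` and `k` fixes `i`, so all off-diagonal entries in a row of the
  -- second-moment matrix agree.
  have hsymm : ∀ i j k, i ≠ j → i ≠ k → ∫ v, a v i * a v j ∂ν = ∫ v, a v i * a v k ∂ν := by
    intro i j k hij hik
    have h := (hν (Equiv.swap j k)).map_eq
    have h2 := integral_map (μ := ν) (f := fun v => a v i * a v k)
      (hν (Equiv.swap j k)).measurable.aemeasurable ((ha i).mul (ha k)).aestronglyMeasurable
    rw [h] at h2
    simp [h2, hσ, Equiv.swap_apply_of_ne_of_ne hij hik]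
  have hdiag0 : ∀ i, 0 ≤ ∫ v, a v i * a v i ∂ν := fun i =>
    integral_nonneg fun v => mul_self_nonneg _
  have hdiag1 : ∀ i, ∫ v, a v i * a v i ∂ν ≤ 1 := fun i => by
    have := integral_mono (hint i i) (integrable_const (1 : ℝ)) (fun v => by
      have := hbd v i
      have h2 := abs_mul_abs_self (a v i)
      have h3 := mul_le_one₀ this (abs_nonneg _) this
      simp only; linarith)
    simpa using this
  -- Each row sums to zero and its diagonal entry is nonnegative, so the common off-diagonal value
  -- cannot be positive.
  have hoff : ∀ i j, i ≠ j → ∫ v, a v i * a v j ∂ν ≤ 0 := by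
    intro i j hij
    have hsum : ∑ k, ∫ v, a v i * a v k ∂ν = 0 := by
      rw [← integral_finsetSum _ fun k _ => hint i k]
      simp [← Finset.mul_sum, h0]
    rw [← Finset.add_sum_erase _ _ (Finset.mem_univ i),
      Finset.sum_congr rfl (g := fun _ => ∫ v, a v i * a v j ∂ν) (fun k hk =>
        hsymm i k j (Finset.ne_of_mem_erase hk).symm hij), Finset.sum_const, nsmul_eq_mul] at hsum
    have hpos : (0 : ℝ) < ((Finset.univ.erase i).card : ℝ) := by
      exact_mod_cast Finset.card_pos.2 ⟨j, by simp [hij.symm]⟩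
    have := hdiag0 i
    by_contra hcon
    have := mul_pos hpos (not_le.1 hcon)
    linarith
  simp_rw [sq, Finset.sum_mul_sum]
  rw [integral_finsetSum _ fun i _ => integrable_finsetSum _ fun j _ => hint i j]
  calc _ ≤ ∑ i ∈ T, (1 : ℝ) := Finset.sum_le_sum fun i hi => by
        rw [integral_finsetSum _ fun j _ => hint i j, ← Finset.add_sum_erase _ _ hi]
        have : ∑ j ∈ T.erase i, ∫ v, a v i * a v j ∂ν ≤ 0 := Finset.sum_nonpos fun j hj =>
          hoff i j (Finset.ne_of_mem_erase hj).symm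
        linarith [hdiag1 i]
    _ = T.card := by simp

/-- Chebyshev's inequality for a function with second moment at most `c`. -/
theorem measureReal_le_of_integral_sq_le {Ω : Type*} [MeasurableSpace Ω] {μ : Measure Ω}
    [IsProbabilityMeasure μ] {f : Ω → ℝ} (hf : Integrable (fun x => f x ^ 2) μ) {c t : ℝ}
    (hc : ∫ x, f x ^ 2 ∂μ ≤ c) (ht : 0 < t) : μ.real {x | t ≤ f x} ≤ c / t ^ 2 := by
  have h := mul_meas_ge_le_integral_of_nonneg (μ := μ) (f := fun x => f x ^ 2)
    (ae_of_all _ fun x => sq_nonneg (f x)) hf (t ^ 2)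
  have hmono : μ.real {x | t ≤ f x} ≤ μ.real {x | t ^ 2 ≤ f x ^ 2} :=
    measureReal_mono fun x hx => pow_le_pow_left₀ ht.le hx 2
  rw [le_div_iff₀ (by positivity)]
  nlinarith [sq_nonneg t]

/-- An equivariant random subset meets the fixed set `T` as if `T` were a sample drawn without
replacement. Chebyshev applies to membership indicators centred at the overall fraction, which sum
to zero. -/
theorem measureReal_card_filter_mem_ge_le {ι V : Type*} [Fintype ι] [DecidableEq ι]
    [MeasurableSpace V] {ν : Measure (ι → V)} [IsProbabilityMeasure ν]
    (hν : ∀ σ : Equiv.Perm ι, MeasurePreserving (fun v : ι → V => v ∘ σ) ν ν)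
    (S : (ι → V) → Finset ι) (hS : ∀ i, MeasurableSet {v | i ∈ S v})
    (hσ : ∀ (σ : Equiv.Perm ι) v i, i ∈ S (v ∘ σ) ↔ σ i ∈ S v)
    {T : Finset ι} (hT : T.Nonempty) {h : ℝ} (hh : 0 < h) :
    ν.real {v | T.card * ((S v).card / Fintype.card ι + h) ≤ ((T.filter (· ∈ S v)).card : ℝ)}
      ≤ 1 / (T.card * h ^ 2) := by
  classical
  have hT' : (0 : ℝ) < T.card := by exact_mod_cast hT.card_pos
  have hN : (0 : ℝ) < Fintype.card ι := by
    exact_mod_cast Fintype.card_pos_iff.2 ⟨hT.choose⟩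
  set a : (ι → V) → ι → ℝ := fun v i => (if i ∈ S v then 1 else 0) - (S v).card / Fintype.card ι
    with ha_def
  have hcard : ∀ v, ((S v).card : ℝ) = ∑ i, if i ∈ S v then (1 : ℝ) else 0 := fun v => by simp
  have ham : ∀ i, Measurable fun v => a v i := by
    intro i
    simp only [ha_def, hcard]
    have : ∀ i, Measurable fun v => if i ∈ S v then (1 : ℝ) else 0 := fun i =>
      Measurable.ite (hS i) measurable_const measurable_const
    fun_prop
  have hcσ : ∀ (σ : Equiv.Perm ι) v, (S (v ∘ σ)).card = (S v).card := fun σ v =>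
    Finset.card_bij (fun i _ => σ i) (fun i hi => (hσ σ v i).1 hi)
      (fun _ _ _ _ h => σ.injective h)
      (fun j hj => ⟨σ.symm j, (hσ σ v _).2 (by simpa using hj), by simp⟩)
  have hle : ∀ v, ((S v).card : ℝ) / Fintype.card ι ≤ 1 := fun v => by
    rw [div_le_one hN]; exact_mod_cast Finset.card_le_univ _
  have hge : ∀ v, 0 ≤ ((S v).card : ℝ) / Fintype.card ι := fun v => by positivity
  have habs : ∀ v i, |a v i| ≤ 1 := fun v i => by
    have := hle v
    have := hge v
    simp only [ha_def]
    rw [abs_le]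
    split_ifs <;> constructor <;> linarith
  have hsum : ∀ v, ∑ i ∈ T, a v i
      = (T.filter (· ∈ S v)).card - T.card * ((S v).card / Fintype.card ι) := fun v => by
    simp [ha_def, Finset.sum_sub_distrib, Finset.filter_mem_eq_inter]
  have key := integral_sq_sum_le_card_of_exchangeable hν ham
    (fun σ v i => by simp only [ha_def, hσ, hcσ]) habs
    (fun v => by
      simp only [ha_def, Finset.sum_sub_distrib, ← hcard]
      simp only [Finset.sum_const, Finset.card_univ, nsmul_eq_mul]
      field_simp
      simp) T
  have hint : Integrable (fun v => (∑ i ∈ T, a v i) ^ 2) ν := by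
    refine Integrable.of_bound (C := (T.card : ℝ) ^ 2) (by fun_prop) (ae_of_all _ fun v => ?_)
    rw [norm_pow]
    gcongr
    calc _ ≤ ∑ i ∈ T, |a v i| := Finset.abs_sum_le_sum_abs _ _
      _ ≤ ∑ i ∈ T, (1 : ℝ) := Finset.sum_le_sum fun i _ => habs v i
      _ = _ := by simp
  have := measureReal_le_of_integral_sq_le hint key (t := T.card * h) (by positivity)
  calc _ = ν.real {v | T.card * h ≤ ∑ i ∈ T, a v i} := by
        congr 1; ext v; simp only [Set.mem_ofPred_eq, hsum]
        constructor <;> intro h <;> linarith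
    _ ≤ _ := this
    _ = _ := by field_simp

/-- In an exchangeable vector, it is unlikely that much more than a fraction `β` of the entries
indexed by `T₂` exceed at least a fraction `1 - β` of the entries indexed by `T₁`. -/
theorem measureReal_card_rank_ge_le {ι : Type*} [Fintype ι] [DecidableEq ι]
    {ν : Measure (ι → ℝ)} [IsProbabilityMeasure ν]
    (hν : ∀ σ : Equiv.Perm ι, MeasurePreserving (fun v : ι → ℝ => v ∘ σ) ν ν)
    {T₁ T₂ : Finset ι} (hT₁ : T₁.Nonempty) (hT₂ : T₂.Nonempty) {β h : ℝ} (hβ : 0 ≤ β)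
    (hh : 0 < h) :
    ν.real {v | (β + 2 * h) * T₂.card ≤ ((T₂.filter fun j =>
        (1 - β) * T₁.card ≤ ((T₁.filter fun i => v i < v j).card : ℝ)).card : ℝ)}
      ≤ 1 / (T₁.card * h ^ 2) + 1 / (T₂.card * h ^ 2) := by
  classical
  -- `K` is a rank cut-off in the whole vector, with margin `h` for sampling error. `H` collects the
  -- entries ranked at or above it, `L` those strictly below some entry not in `H`. Their overall
  -- fractions, at most `β + h` and `1 - β - h` (the latter if `H` misses some index), each gain
  -- less than `h` on `T₂` and `T₁`.
  set K : ℝ := (1 - β - h) * Fintype.card ι with hK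
  have hN : (0 : ℝ) < Fintype.card ι := by
    exact_mod_cast Fintype.card_pos_iff.2 ⟨hT₁.choose⟩
  set below : (ι → ℝ) → ι → Finset ι := fun v j => Finset.univ.filter fun l => v l < v j
    with hbelow
  set H : (ι → ℝ) → Finset ι := fun v => Finset.univ.filter fun j => K ≤ (below v j).card with hH
  set L : (ι → ℝ) → Finset ι := fun v => Finset.univ.filter fun l => ∃ j, v l < v j ∧
    (below v j).card < K with hL
  have hbm : ∀ j, Measurable fun v => ((below v j).card : ℝ) := fun j => by
    have : ∀ v, ((below v j).card : ℝ) = ∑ l, if v l < v j then (1 : ℝ) else 0 := by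
      simp [hbelow]
    simp only [this]
    refine Finset.measurable_sum _ fun l _ => Measurable.ite ?_ measurable_const measurable_const
    exact measurableSet_lt (measurable_pi_apply l) (measurable_pi_apply j)
  have hbσ : ∀ (σ : Equiv.Perm ι) v j, (below (v ∘ σ) j).card = (below v (σ j)).card :=
    fun σ v j => Finset.card_bij (fun i _ => σ i) (fun i hi => by simpa [hbelow] using hi)
      (fun _ _ _ _ h => σ.injective h)
      (fun j hj => ⟨σ.symm j, by simpa [hbelow] using hj, by simp⟩)
  have h1 := measureReal_card_filter_mem_ge_le hν L
    (fun l => by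
      simp only [hL, Finset.mem_filter, Finset.mem_univ, true_and, Set.ofPred_exists]
      refine MeasurableSet.iUnion fun j => MeasurableSet.inter ?_ ?_
      · exact measurableSet_lt (measurable_pi_apply l) (measurable_pi_apply j)
      · exact measurableSet_lt (hbm j) measurable_const)
    (fun σ v i => by
      simp only [hL, Finset.mem_filter, Finset.mem_univ, true_and, hbσ, Function.comp_apply]
      exact ⟨fun ⟨j, hj⟩ => ⟨σ j, hj⟩, fun ⟨j, hj⟩ => ⟨σ.symm j, by simpa using hj⟩⟩) hT₁ hh
  have h2 := measureReal_card_filter_mem_ge_le hν H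
    (fun j => by
      simp only [hH, Finset.mem_filter, Finset.mem_univ, true_and]
      exact measurableSet_le measurable_const (hbm j))
    (fun σ v i => by simp [hH, hbσ]) hT₂ hh
  refine le_trans ?_ (add_le_add h1 h2)
  refine (measureReal_mono ?_).trans (measureReal_union_le _ _)
  intro v hv
  simp only [Set.mem_ofPred_eq, Set.mem_union] at hv ⊢
  by_contra! hcon
  obtain ⟨hc1, hc2⟩ := hcon
  have hT₁' : (0 : ℝ) < T₁.card := by exact_mod_cast hT₁.card_pos
  have hT₂' : (0 : ℝ) < T₂.card := by exact_mod_cast hT₂.card_pos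
  -- The at least `K` entries below the smallest member of `H` all lie outside `H`.
  have hHcard : ((H v).card : ℝ) / Fintype.card ι ≤ β + h := by
    rw [div_le_iff₀ hN]
    rcases (H v).eq_empty_or_nonempty with he | hne
    · rw [he]; simp only [Finset.card_empty, Nat.cast_zero]; positivity
    · obtain ⟨j, hj, hmin⟩ := (H v).exists_min_image v hne
      have hdisj : Disjoint (H v) (below v j) := Finset.disjoint_left.2 fun l hl hl' => by
        have := hmin l hl
        simp only [hbelow, Finset.mem_filter, Finset.mem_univ, true_and] at hl'
        linarith
      have hcard : ((H v).card : ℝ) + (below v j).card ≤ Fintype.card ι := by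
        rw [← Nat.cast_add, ← Finset.card_union_of_disjoint hdisj]
        exact_mod_cast Finset.card_le_univ _
      have : K ≤ (below v j).card := by simpa [hH] using hj
      rw [hK] at this
      linarith
  have hsub : (T₂.filter fun j =>
        (1 - β) * T₁.card ≤ ((T₁.filter fun i => v i < v j).card : ℝ)) ⊆ T₂.filter (· ∈ H v) := by
    intro j hj
    simp only [Finset.mem_filter] at hj ⊢
    refine ⟨hj.1, ?_⟩
    by_contra hjH
    have hjK : ((below v j).card : ℝ) < K := by simpa [hH] using hjH
    have hLcard : ((L v).card : ℝ) / Fintype.card ι ≤ 1 - β - h := by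
      rw [div_le_iff₀ hN]
      -- All of `L` lies below the largest entry outside `H`, which has fewer than `K` entries below
      -- it.
      obtain ⟨j', hj', hmax⟩ := (Finset.univ.filter fun j => ((below v j).card : ℝ) < K)
        |>.exists_max_image v ⟨j, by simpa using hjK⟩
      have : L v ⊆ below v j' := fun l hl => by
        simp only [hL, Finset.mem_filter, Finset.mem_univ, true_and] at hl
        obtain ⟨k, hk, hkK⟩ := hl
        have := hmax k (by simpa using hkK)
        simp only [hbelow, Finset.mem_filter, Finset.mem_univ, true_and]
        linarith
      have h3 : ((L v).card : ℝ) ≤ (below v j').card := by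
        exact_mod_cast Finset.card_le_card this
      have h4 : ((below v j').card : ℝ) < K := by simpa using hj'
      linarith
    have h5 : ((T₁.filter fun i => v i < v j).card : ℝ) ≤ (T₁.filter (· ∈ L v)).card := by
      norm_cast
      refine Finset.card_le_card (Finset.monotone_filter_right _ fun l _ hl => ?_)
      simp only [hL, Finset.mem_filter, Finset.mem_univ, true_and]
      exact ⟨j, hl, hjK⟩
    have h6 : (T₁.card : ℝ) * ((L v).card / Fintype.card ι + h) ≤ T₁.card * (1 - β) := by
      gcongr; linarith
    linarith [hj.2]
  have h7 : ((T₂.filter fun j =>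
        (1 - β) * T₁.card ≤ ((T₁.filter fun i => v i < v j).card : ℝ)).card : ℝ)
        ≤ (T₂.filter (· ∈ H v)).card := by
    exact_mod_cast Finset.card_le_card hsub
  have h8 : (T₂.card : ℝ) * ((H v).card / Fintype.card ι + h) ≤ T₂.card * (β + 2 * h) :=
    mul_le_mul_of_nonneg_left (by linarith) hT₂'.le
  linarith

/-- Markov's inequality for the count. No independence is required, which matters because the events
it is applied to share data. -/
theorem measureReal_card_filter_ge_le {Ω κ : Type*} [MeasurableSpace Ω] [Fintype κ]
    {μ : Measure Ω} [IsProbabilityMeasure μ] {E : κ → Set Ω} (hE : ∀ j, MeasurableSet (E j))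
    {p c : ℝ} (hp : ∀ j, μ.real (E j) ≤ p) (hc : 0 < c) [∀ ω j, Decidable (ω ∈ E j)] :
    μ.real {ω | c ≤ ((Finset.univ.filter fun j => ω ∈ E j).card : ℝ)}
      ≤ Fintype.card κ * p / c := by
  have hcard : ∀ ω, ((Finset.univ.filter fun j => ω ∈ E j).card : ℝ)
      = ∑ j, (E j).indicator (fun _ => (1 : ℝ)) ω := fun ω => by
    simp [Set.indicator_apply]
  simp only [hcard]
  have hi : ∀ j, Integrable ((E j).indicator fun _ => (1 : ℝ)) μ := fun j =>
    (integrable_const 1).indicator (hE j)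
  have h := mul_meas_ge_le_integral_of_nonneg (μ := μ)
    (f := fun ω => ∑ j, (E j).indicator (fun _ => (1 : ℝ)) ω)
    (ae_of_all _ fun ω => Finset.sum_nonneg fun j _ => Set.indicator_nonneg (by simp) _)
    (integrable_finsetSum _ fun j _ => hi j) c
  rw [integral_finsetSum _ fun j _ => hi j] at h
  rw [le_div_iff₀ hc, mul_comm]
  refine h.trans ?_
  calc _ ≤ ∑ _j : κ, p := Finset.sum_le_sum fun j _ => by
        rw [integral_indicator_const _ (hE j)]; simpa using hp j
    _ = _ := by simp

/-- The empirical frequency of `B` among `m` independent draws is unlikely to be well below the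
probability of `B`. -/
theorem pi_card_filter_mem_le {Z : Type*} [MeasurableSpace Z] (P : Measure Z)
    [IsProbabilityMeasure P] {B : Set Z} (hB : MeasurableSet B) [DecidablePred (· ∈ B)] {m : ℕ}
    (hm : 0 < m) {h : ℝ} (hh : 0 < h) :
    (Measure.pi fun _ : Fin m => P).real
      {z | ((Finset.univ.filter fun j => z j ∈ B).card : ℝ) ≤ (P.real B - h) * m}
      ≤ 1 / (m * h ^ 2) := by
  have hm' : (0 : ℝ) < m := by exact_mod_cast hm
  set g : Z → ℝ := B.indicator fun _ => 1 with hg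
  have hgm : Measurable g := measurable_const.indicator hB
  have hg2 : MemLp g 2 P := MemLp.of_bound hgm.aestronglyMeasurable 1 (ae_of_all _ fun z => by
    simp only [hg, Set.indicator_apply]; split_ifs <;> simp)
  set Y : (Fin m → Z) → ℝ := fun z => ∑ j, g (z j) with hY
  have hmp : ∀ j : Fin m, MeasurePreserving (fun z : Fin m → Z => z j)
      (Measure.pi fun _ => P) P := fun j => measurePreserving_eval (fun _ => P) j
  have hmem : ∀ j : Fin m, MemLp (fun z : Fin m → Z => g (z j)) 2 (Measure.pi fun _ => P) :=
    fun j => hg2.comp_measurePreserving (hmp j)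
  have hYm : MemLp Y 2 (Measure.pi fun _ => P) := memLp_finsetSum _ fun j _ => hmem j
  have hmean : ∫ z, Y z ∂(Measure.pi fun _ : Fin m => P) = m * P.real B := by
    rw [hY, integral_finsetSum _ fun j _ => (hmem j).integrable one_le_two]
    have : ∀ j : Fin m, ∫ z, g (z j) ∂(Measure.pi fun _ : Fin m => P) = P.real B := fun j => by
      rw [integral_comp_eval (μ := fun _ : Fin m => P) hgm.aestronglyMeasurable, hg,
        integral_indicator_const _ hB]
      simp
    simp [this]
  have hvar : ProbabilityTheory.variance Y (Measure.pi fun _ : Fin m => P) ≤ m := by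
    have h1 := ProbabilityTheory.variance_sum_pi (μ := fun _ : Fin m => P) (X := fun _ => g)
      (fun _ => hg2)
    have h2 : Y = ∑ j, fun z : Fin m → Z => g (z j) := by ext z; simp [hY]
    rw [h2, h1]
    have h3 : ProbabilityTheory.variance g P ≤ 1 := by
      refine (ProbabilityTheory.variance_le_expectation_sq hgm.aestronglyMeasurable).trans ?_
      have : ∫ z, (g ^ 2) z ∂P ≤ ∫ z, (1 : ℝ) ∂P := by
        refine integral_mono hg2.integrable_sq (integrable_const _) fun z => ?_
        simp only [hg, Pi.pow_apply, Set.indicator_apply]; split_ifs <;> simp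
      simpa using this
    calc _ ≤ ∑ _j : Fin m, (1 : ℝ) := Finset.sum_le_sum fun _ _ => h3
      _ = m := by simp
  have hvar' := ProbabilityTheory.variance_eq_integral hYm.aestronglyMeasurable.aemeasurable
  rw [hvar', hmean] at hvar
  have hint : Integrable (fun z => (m * P.real B - Y z) ^ 2) (Measure.pi fun _ : Fin m => P) :=
    ((memLp_const _).sub hYm).integrable_sq
  have := measureReal_le_of_integral_sq_le hint (c := m) (by
    simpa [sub_sq_comm] using hvar) (t := m * h) (by positivity)
  calc _ = (Measure.pi fun _ : Fin m => P).real {z | m * h ≤ m * P.real B - Y z} := by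
        congr 1; ext z
        have : ((Finset.univ.filter fun j => z j ∈ B).card : ℝ) = Y z := by
          simp [hY, hg, Set.indicator_apply]
        simp only [Set.mem_ofPred_eq, this]
        constructor <;> intro h <;> linarith
    _ ≤ _ := this
    _ = _ := by field_simp

/-! ### Residuals, stability and the miscoverage event. -/

namespace RegressionAlgorithm

variable {X : Type*} [MeasurableSpace X] (A : RegressionAlgorithm X)

/-- Choosing preimages under `f` gives an injective self-map of `Fin k`, hence a permutation, and
the fit ignores order. -/
theorem fit_comp_eq_of_range_subset {ι : Type*} {k : ℕ} {e f : Fin k → ι}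
    (he : Function.Injective e) (h : Set.range e ⊆ Set.range f)
    (ω : ι → X × ℝ) : A.fit k (fun a => ω (e a)) = A.fit k (fun a => ω (f a)) := by
  choose σ hσ using fun a => h ⟨a, rfl⟩
  have hinj : Function.Injective σ := fun a b hab => he (by rw [← hσ, ← hσ, hab])
  rw [← A.symmetric k (Equiv.ofBijective σ (Finite.injective_iff_bijective.1 hinj))
    fun a => ω (f a)]
  congr 1
  funext a
  simp [hσ]

/-- The absolute residual at the data point with index `i` of the model fitted to the data points
with indices `e 0, …, e (k - 1)`. -/
noncomputable def residual {ι : Type*} {k : ℕ} (e : Fin k → ι) (ω : ι → X × ℝ) (i : ι) : ℝ :=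
  |(ω i).2 - A.fit k (fun a => ω (e a)) (ω i).1|

@[fun_prop]
theorem measurable_fit_comp {V : Type*} [MeasurableSpace V] {k : ℕ} {D : V → Fin k → X × ℝ}
    {x : V → X} (hD : Measurable D) (hx : Measurable x) :
    Measurable fun v => A.fit k (D v) (x v) :=
  (A.measurable_fit k).comp (hD.prodMk hx)

theorem measurable_residual {ι : Type*} {k : ℕ} (e : Fin k → ι) (i : ι) :
    Measurable fun ω => A.residual e ω i := by
  unfold residual
  have : Measurable fun (ω : ι → X × ℝ) => A.fit k (fun a => ω (e a)) (ω i).1 :=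
    A.measurable_fit_comp (by fun_prop) (by fun_prop)
  have h2 : Measurable fun (ω : ι → X × ℝ) => (ω i).2 := by fun_prop
  exact (h2.sub this).abs

/-- The residuals of the model fitted to all of the data are exchangeable. -/
theorem measurePreserving_comp_perm_residual {ι : Type*} [Fintype ι] {k : ℕ} (e : Fin k ≃ ι)
    (P : Measure (X × ℝ)) [IsProbabilityMeasure P] (σ : Equiv.Perm ι) :
    MeasurePreserving (fun v : ι → ℝ => v ∘ σ)
      ((Measure.pi fun _ => P).map (A.residual e)) ((Measure.pi fun _ => P).map (A.residual e)) := by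
  have hm : Measurable (A.residual e) := measurable_pi_iff.2 fun i => A.measurable_residual e i
  -- Permuting the data leaves the full model unchanged and so merely permutes its residuals.
  refine MeasurePreserving.of_semiconj (f := A.residual e) ⟨hm, rfl⟩
    (measurePreserving_pi_comp_injective P σ.injective) (fun ω => ?_) (by fun_prop)
  funext i
  simp only [residual, Function.comp_apply]
  rw [A.fit_comp_eq_of_range_subset (e := fun a => σ (e a)) (f := e)
    (σ.injective.comp e.injective) (by simp [e.surjective.range_eq])]

theorem measurable_inSampleStability_integrand (m n : ℕ) (hn : 0 < n) :
    Measurable fun D : Fin (n + m) → X × ℝ =>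
      ENNReal.ofReal |A.fit n (fun i => D (Fin.castAdd m i)) (D (Fin.castAdd m ⟨0, hn⟩)).1
        - A.fit (n + m) D (D (Fin.castAdd m ⟨0, hn⟩)).1| := by
  have h1 : Measurable fun D : Fin (n + m) → X × ℝ =>
      A.fit n (fun i => D (Fin.castAdd m i)) (D (Fin.castAdd m ⟨0, hn⟩)).1 :=
    A.measurable_fit_comp (by fun_prop) (by fun_prop)
  have h2 : Measurable fun D : Fin (n + m) → X × ℝ =>
      A.fit (n + m) D (D (Fin.castAdd m ⟨0, hn⟩)).1 :=
    A.measurable_fit_comp (by fun_prop) (by fun_prop)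
  exact (h1.sub h2).abs.ennreal_ofReal

/-- In-sample `m`-stability accumulates at most linearly in `m`. -/
theorem inSampleStability_le_mul (P : ProbabilityMeasure (X × ℝ)) (m n : ℕ) (hn : 0 < n) :
    inSampleStability A P m n hn ≤ m * supInSampleStability A P n hn := by
  induction m with
  | zero =>
    simp only [Nat.cast_zero, zero_mul, nonpos_iff_eq_zero]
    unfold inSampleStability
    simp [Fin.castAdd_zero]
  | succ m ih =>
    have hsup : inSampleStability A P 1 (n + m) (by omega) ≤ supInSampleStability A P n hn :=
      le_iSup₂_of_le (n + m) (by omega) le_rfl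
    have hmp := measurePreserving_pi_comp_injective (P : Measure (X × ℝ))
      (Fin.castAdd_injective (n + m) 1)
    have hm := A.measurable_inSampleStability_integrand m n hn
    calc inSampleStability A P (m + 1) n hn
        ≤ inSampleStability A P m n hn + inSampleStability A P 1 (n + m) (by omega) := by
          unfold inSampleStability iidLaw
          rw [← hmp.lintegral_comp hm]
          refine le_trans ?_ (lintegral_add_left (hm.comp hmp.measurable) _).le
          refine lintegral_mono fun D => ?_
          refine le_trans ?_ (ENNReal.ofReal_add (abs_nonneg _) (abs_nonneg _)).le
          exact ENNReal.ofReal_le_ofReal (abs_sub_le _ _ _)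
      _ ≤ m * supInSampleStability A P n hn + supInSampleStability A P n hn := add_le_add ih hsup
      _ = _ := by push_cast; ring

/-- The in-sample stability controls the change of the fitted value at any data point `f a` that is
used by both the small and the large model. -/
theorem lintegral_abs_fit_sub_fit {ι : Type*} [Fintype ι] [DecidableEq ι]
    (P : ProbabilityMeasure (X × ℝ)) {p k N : ℕ} (hN : N = p + k) {f : Fin p → ι}
    (hf : Function.Injective f) (g : Fin N ≃ ι) (a : Fin p) (hp : 0 < p) :
    ∫⁻ ω : ι → X × ℝ, ENNReal.ofReal |A.fit p (fun l => ω (f l)) (ω (f a)).1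
      - A.fit N (fun l => ω (g l)) (ω (f a)).1| ∂(Measure.pi fun _ => (P : Measure (X × ℝ)))
      = inSampleStability A P k p hp := by
  subst hN
  -- Stability is measured at the first draw, so the point `f a` is moved to the front. The
  -- reindexing is then extended to all `p + k` points; the filler `f a` in `Fin.append` is never
  -- used.
  set f' : Fin p → ι := f ∘ Equiv.swap ⟨0, hp⟩ a with hf'_def
  have hf' : Function.Injective f' := hf.comp (Equiv.injective _)
  have hcard : Fintype.card (Fin (p + k)) = (Finset.univ : Finset ι).card := by
    rw [Finset.card_univ, Fintype.card_congr g]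
  obtain ⟨e, he⟩ := Finset.exists_equiv_extend_of_card_eq hcard
    (s := Finset.univ.image (Fin.castAdd k)) (f := Fin.append f' fun _ => f a)
    (Finset.subset_univ _) (by
      intro x hx y hy hxy
      simp only [Finset.coe_image, Finset.coe_univ, Set.image_univ, Set.mem_range] at hx hy
      obtain ⟨x, rfl⟩ := hx
      obtain ⟨y, rfl⟩ := hy
      simp only [Fin.append_left] at hxy
      rw [hf' hxy])
  have he' : ∀ l : Fin p, (e (Fin.castAdd k l) : ι) = f' l := fun l => by
    rw [he _ (by simp), Fin.append_left]
  have hinj : Function.Injective fun l => (e l : ι) := Subtype.val_injective.comp e.injective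
  have hmp := measurePreserving_pi_comp_injective (P : Measure (X × ℝ)) hinj
  unfold inSampleStability iidLaw
  rw [← hmp.lintegral_comp (A.measurable_inSampleStability_integrand k p hp)]
  refine lintegral_congr fun ω => ?_
  simp only [he']
  rw [A.fit_comp_eq_of_range_subset (f := f') hf (by
      rw [hf'_def, Set.range_comp, (Equiv.surjective _).range_eq, Set.image_univ]),
    A.fit_comp_eq_of_range_subset (f := fun l => (e l : ι)) g.injective (by
      rintro _ ⟨l, rfl⟩
      exact ⟨e.symm ⟨g l, Finset.mem_univ _⟩, by simp⟩)]
  simp [hf'_def]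

/-- A residual is 1-Lipschitz in the fitted value, so Markov's inequality and the accumulated
stability over `k` added points suffice. -/
theorem measureReal_abs_residual_sub_residual_gt_le {ι : Type*} [Fintype ι] [DecidableEq ι]
    (P : ProbabilityMeasure (X × ℝ)) {p k N : ℕ} (hN : N = p + k) {f : Fin p → ι}
    (hf : Function.Injective f) (g : Fin N ≃ ι) (a : Fin p) (hp : 0 < p) {b t : ℝ} (hb : 0 ≤ b)
    (ht : 0 < t) (hstab : supInSampleStability A P p hp ≤ ENNReal.ofReal b) :
    (Measure.pi fun _ => (P : Measure (X × ℝ))).real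
      {ω : ι → X × ℝ | t < |A.residual f ω (f a) - A.residual g ω (f a)|} ≤ k * b / t := by
  set μ : Measure (ι → X × ℝ) := Measure.pi fun _ => (P : Measure (X × ℝ))
  have h1 : Measurable fun ω : ι → X × ℝ => A.fit p (fun l => ω (f l)) (ω (f a)).1 :=
    A.measurable_fit_comp (by fun_prop) (by fun_prop)
  have h2 : Measurable fun ω : ι → X × ℝ => A.fit N (fun l => ω (g l)) (ω (f a)).1 :=
    A.measurable_fit_comp (by fun_prop) (by fun_prop)
  have hm := (h1.sub h2).abs.ennreal_ofReal
  have hM := meas_ge_le_lintegral_div (μ := μ) hm.aemeasurable (ε := ENNReal.ofReal t)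
    (by simpa using ht) ENNReal.ofReal_ne_top
  have hbound : μ {ω | t < |A.residual f ω (f a) - A.residual g ω (f a)|}
      ≤ ENNReal.ofReal (k * b / t) := by
    calc _ ≤ _ := measure_mono (fun ω hω => by
          refine ENNReal.ofReal_le_ofReal (le_of_lt (lt_of_lt_of_le hω ?_))
          refine (abs_abs_sub_abs_le_abs_sub _ _).trans_eq ?_
          rw [← abs_neg]
          congr 1
          simp)
      _ ≤ _ := hM
      _ ≤ ENNReal.ofReal (k * b) / ENNReal.ofReal t := by
          gcongr
          refine (A.lintegral_abs_fit_sub_fit P hN hf g a hp).trans_le ?_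
          refine (A.inSampleStability_le_mul P k p hp).trans ?_
          rw [ENNReal.ofReal_mul (by positivity), ENNReal.ofReal_natCast]
          gcongr
      _ = _ := (ENNReal.ofReal_div_of_pos ht).symm
  exact ENNReal.toReal_le_of_le_ofReal (by positivity) hbound

/-- The pairs of a training set and a test point such that at least `c` of the training residuals
are below the test residual by more than `γ`, where the residuals are those of the model fitted to
the training set together with the test point. -/
def exceedanceSet (γ c : ℝ) (n : ℕ) : Set ((Fin n → X × ℝ) × (X × ℝ)) :=
  {q | c ≤ ((Finset.univ.filter fun i : Fin n =>
    |(q.1 i).2 - augmentedFit A q.1 q.2.1 q.2.2 (q.1 i).1|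
      < |q.2.2 - augmentedFit A q.1 q.2.1 q.2.2 q.2.1| - γ).card : ℝ)}

theorem measurableSet_exceedanceSet (γ c : ℝ) (n : ℕ) :
    MeasurableSet (A.exceedanceSet γ c n) := by
  have hsnoc : Measurable fun q : (Fin n → X × ℝ) × (X × ℝ) =>
      (Fin.snoc q.1 (q.2.1, q.2.2) : Fin (n + 1) → X × ℝ) := by
    refine measurable_pi_iff.2 fun i => ?_
    refine Fin.lastCases ?_ (fun i => ?_) i
    · simpa using measurable_snd
    · simp only [Fin.snoc_castSucc]; fun_prop
  have hfit : ∀ x : (Fin n → X × ℝ) × (X × ℝ) → X, Measurable x →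
      Measurable fun q : (Fin n → X × ℝ) × (X × ℝ) => augmentedFit A q.1 q.2.1 q.2.2 (x q) :=
    fun x hx => A.measurable_fit_comp hsnoc hx
  have hind : ∀ i, Measurable fun q : (Fin n → X × ℝ) × (X × ℝ) =>
      if |(q.1 i).2 - augmentedFit A q.1 q.2.1 q.2.2 (q.1 i).1|
        < |q.2.2 - augmentedFit A q.1 q.2.1 q.2.2 q.2.1| - γ then (1 : ℝ) else 0 := fun i => by
    have h1 := hfit (fun q => (q.1 i).1) (by fun_prop)
    have h2 := hfit (fun q => q.2.1) (by fun_prop)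
    refine Measurable.ite (measurableSet_lt ?_ ?_) measurable_const measurable_const
    · exact (Measurable.sub (by fun_prop) h1).abs
    · exact (Measurable.sub (by fun_prop) h2).abs.sub_const γ
  refine measurableSet_le measurable_const ?_
  simp only [Finset.natCast_card_filter]
  exact Finset.measurable_sum _ fun i _ => hind i

/-- A test residual exceeding the quantile by more than `γ` leaves room for some admissible `t`
below it; attainment of the infimum is not needed. This inclusion replaces the miscoverage event by
one known to be measurable. -/
theorem mem_exceedanceSet_of_notMem_conformalSet {α γ : ℝ} {n : ℕ} (hn : 0 < n)
    {D : Fin n → X × ℝ} {p : X × ℝ} (h : p.2 ∉ conformalSet A α γ D p.1) :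
    (D, p) ∈ A.exceedanceSet γ ((1 - α) * (n + 1)) n := by
  have hn' : (0 : ℝ) < n := by exact_mod_cast hn
  simp only [conformalSet, Set.mem_ofPred_eq, not_le] at h
  rw [← EReal.lt_sub_iff_add_lt (by simp) (by simp), ← EReal.coe_sub, empiricalQuantile,
    sInf_lt_iff] at h
  obtain ⟨_, ⟨t, ht, rfl⟩, hlt⟩ := h
  rw [EReal.coe_lt_coe_iff] at hlt
  simp only [Set.mem_ofPred_eq] at ht
  have hτ : (1 - α) * (1 + 1 / (n : ℝ)) * n = (1 - α) * (n + 1) := by field_simp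
  rw [hτ] at ht
  refine ht.trans ?_
  norm_cast
  exact Finset.card_le_card (Finset.monotone_filter_right _ fun i _ hi => lt_of_le_of_lt hi hlt)

end RegressionAlgorithm

/-! ### Comparison with auxiliary test points. -/

/-- A conditional version of `pi_card_filter_mem_le`. -/
theorem prod_pi_card_filter_mem_le {W Z : Type*} [MeasurableSpace W] [MeasurableSpace Z]
    (ρ : Measure W) [IsProbabilityMeasure ρ] (P : Measure Z) [IsProbabilityMeasure P]
    {B : Set (W × Z)} (hB : MeasurableSet B) [DecidablePred (· ∈ B)] {m : ℕ} (hm : 0 < m) {h : ℝ}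
    (hh : 0 < h) :
    MeasurableSet {q : W × (Fin m → Z) | ((Finset.univ.filter fun j => (q.1, q.2 j) ∈ B).card : ℝ)
        ≤ (P.real (Prod.mk q.1 ⁻¹' B) - h) * m} ∧
    (ρ.prod (Measure.pi fun _ : Fin m => P)).real
      {q | ((Finset.univ.filter fun j => (q.1, q.2 j) ∈ B).card : ℝ)
        ≤ (P.real (Prod.mk q.1 ⁻¹' B) - h) * m} ≤ 1 / (m * h ^ 2) := by
  have hf : Measurable fun w => P.real (Prod.mk w ⁻¹' B) :=
    (measurable_measure_prodMk_left hB).ennreal_toReal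
  have hE : MeasurableSet {q : W × (Fin m → Z) |
      ((Finset.univ.filter fun j => (q.1, q.2 j) ∈ B).card : ℝ)
        ≤ (P.real (Prod.mk q.1 ⁻¹' B) - h) * m} := by
    refine measurableSet_le ?_ (((hf.comp measurable_fst).sub_const h).mul_const _)
    simp only [Finset.natCast_card_filter]
    refine Finset.measurable_sum _ fun j _ => Measurable.ite ?_ measurable_const measurable_const
    exact (show Measurable fun q : W × (Fin m → Z) => (q.1, q.2 j) by fun_prop) hB
  refine ⟨hE, ENNReal.toReal_le_of_le_ofReal (by positivity) ?_⟩
  rw [Measure.prod_apply hE]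
  calc _ ≤ ∫⁻ _w, ENNReal.ofReal (1 / (m * h ^ 2)) ∂ρ := lintegral_mono fun w => by
        let hdec : DecidablePred (· ∈ Prod.mk w ⁻¹' B) := fun z =>
          inferInstanceAs (Decidable ((w, z) ∈ B))
        have := pi_card_filter_mem_le P (measurable_prodMk_left (x := w) hB) hm hh
        rw [ENNReal.le_ofReal_iff_toReal_le (measure_ne_top _ _) (by positivity)]
        exact this
    _ = _ := by simp

theorem Fin.snoc_inl_inr_injective {n m : ℕ} (j : Fin m) :
    Function.Injective (Fin.snoc Sum.inl (Sum.inr j) : Fin (n + 1) → Fin n ⊕ Fin m) := by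
  intro a b
  refine Fin.lastCases (Fin.lastCases ?_ (fun b => ?_) b)
    (fun a => Fin.lastCases ?_ (fun b => ?_) b) a <;> simp

theorem RegressionAlgorithm.mk_mem_exceedanceSet_iff {X : Type*} [MeasurableSpace X]
    (A : RegressionAlgorithm X) {γ c : ℝ} {n m : ℕ} (ω : Fin n ⊕ Fin m → X × ℝ) (j : Fin m) :
    ((fun i => ω (Sum.inl i)), ω (Sum.inr j)) ∈ A.exceedanceSet γ c n ↔
      c ≤ ((Finset.univ.filter fun i : Fin n =>
        A.residual (Fin.snoc Sum.inl (Sum.inr j) : Fin (n + 1) → Fin n ⊕ Fin m) ω (Sum.inl i)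
          < A.residual (Fin.snoc Sum.inl (Sum.inr j) : Fin (n + 1) → Fin n ⊕ Fin m) ω (Sum.inr j)
            - γ).card : ℝ) := by
  have h : (Fin.snoc (fun i => ω (Sum.inl i)) (ω (Sum.inr j)) : Fin (n + 1) → X × ℝ)
      = fun a => ω ((Fin.snoc Sum.inl (Sum.inr j) : Fin (n + 1) → Fin n ⊕ Fin m) a) := by
    funext a
    refine Fin.lastCases ?_ (fun a => ?_) a <;> simp
  simp only [RegressionAlgorithm.exceedanceSet, augmentedFit, RegressionAlgorithm.residual,
    Set.mem_ofPred_eq, Prod.mk.eta, h]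
  rfl

/-- A non-asymptotic bound on the training-conditional miscoverage of inflated full conformal
prediction for a stable algorithm, with `m` the number of auxiliary test points. -/
theorem iidLaw_conformalMiscoverage_ge_le {X : Type*} [MeasurableSpace X]
    (A : RegressionAlgorithm X) (P : ProbabilityMeasure (X × ℝ)) {α b γ h δ : ℝ} (hα0 : 0 ≤ α)
    (hα1 : α ≤ 1) {n m : ℕ} (hn : 0 < n) (hm : 0 < m) (hb : 0 ≤ b) (hγ : 0 < γ) (hh : 0 < h)
    (hδ : 0 < δ) (hstab : supInSampleStability A P (n + 1) n.succ_pos ≤ ENNReal.ofReal b) :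
    iidLaw P n {D | α + 3 * h + 2 * δ ≤ conformalMiscoverage A P α γ D}
      ≤ ENNReal.ofReal (1 / (n * h ^ 2) + 2 / (m * h ^ 2)
        + (2 * m * b / γ + 2 * m * b / γ / δ) / δ) := by
  classical
  -- Each conformal model already contains one test point, so only `k = m - 1` points separate it
  -- from the full model.
  obtain ⟨k, rfl⟩ : ∃ k, m = k + 1 := ⟨m - 1, by omega⟩
  set m := k + 1 with hmk
  have hn' : (0 : ℝ) < n := by exact_mod_cast hn
  have hm' : (0 : ℝ) < m := by exact_mod_cast hm
  set s : ℝ := 2 * m * b / γ with hs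
  set μ : Measure (Fin n ⊕ Fin m → X × ℝ) := Measure.pi fun _ => (P : Measure (X × ℝ)) with hμ
  set f : Fin m → Fin (n + 1) → Fin n ⊕ Fin m := fun j => Fin.snoc Sum.inl (Sum.inr j) with hf
  set g : Fin (n + m) ≃ Fin n ⊕ Fin m := finSumFinEquiv.symm
  set R := A.residual g with hR
  set Q : Fin m → (Fin n ⊕ Fin m → X × ℝ) → Fin n ⊕ Fin m → ℝ := fun j => A.residual (f j) with hQ
  set B := A.exceedanceSet γ ((1 - α) * (n + 1)) n with hBdef
  have hB : MeasurableSet B := A.measurableSet_exceedanceSet _ _ _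
  set F : (Fin n → X × ℝ) → ℝ := fun D => (P : Measure (X × ℝ)).real (Prod.mk D ⁻¹' B) with hF
  have hFm : Measurable F := (measurable_measure_prodMk_left hB).ennreal_toReal
  have hmis : ∀ D : Fin n → X × ℝ, conformalMiscoverage A P α γ D ≤ F D := fun D =>
    measureReal_mono fun p hp => A.mem_exceedanceSet_of_notMem_conformalSet hn hp
  set E₁ : Set (Fin n ⊕ Fin m → X × ℝ) :=
    {ω | ((Finset.univ.filter fun j => ((fun i => ω (Sum.inl i)), ω (Sum.inr j)) ∈ B).card : ℝ)
      ≤ (F (fun i => ω (Sum.inl i)) - h) * m} with hE₁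
  have hμE₁ : μ.real E₁ ≤ 1 / (m * h ^ 2) := by
    obtain ⟨hmeas, hle⟩ := prod_pi_card_filter_mem_le
      (Measure.pi fun _ : Fin n => (P : Measure (X × ℝ))) (P : Measure (X × ℝ)) hB hm hh
    have hmp := measurePreserving_sumPiEquivProdPi
      (fun _ : Fin n ⊕ Fin m => (P : Measure (X × ℝ)))
    rw [← hmp.measureReal_preimage hmeas.nullMeasurableSet] at hle
    exact hle
  set E₂ : Set (Fin n ⊕ Fin m → X × ℝ) :=
    {ω | (α + δ + 2 * h) * m ≤ ((Finset.univ.filter fun j : Fin m => (1 - (α + δ)) * n ≤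
      ((Finset.univ.filter fun i : Fin n =>
        R ω (Sum.inl i) < R ω (Sum.inr j)).card : ℝ)).card : ℝ)} with hE₂
  have hRm : Measurable R := measurable_pi_iff.2 fun i => A.measurable_residual g i
  have hμE₂ : μ.real E₂ ≤ 1 / (n * h ^ 2) + 1 / (m * h ^ 2) := by
    have : IsProbabilityMeasure (μ.map R) := Measure.isProbabilityMeasure_map hRm.aemeasurable
    have : Nonempty (Fin n) := ⟨⟨0, hn⟩⟩
    have hrank := measureReal_card_rank_ge_le
      (A.measurePreserving_comp_perm_residual g (P : Measure (X × ℝ)))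
      (T₁ := Finset.univ.map (Function.Embedding.inl : Fin n ↪ Fin n ⊕ Fin m))
      (T₂ := Finset.univ.map (Function.Embedding.inr : Fin m ↪ Fin n ⊕ Fin m))
      (by simp) (by simp) (add_nonneg hα0 hδ.le) hh
    simp only [Finset.filter_map, Finset.card_map, Finset.card_univ, Fintype.card_fin] at hrank
    refine le_trans ?_ hrank
    refine ENNReal.toReal_mono (measure_ne_top _ _) ?_
    -- Only this inequality is needed, so measurability of the rank event need not be proved.
    exact Measure.le_map_apply hRm.aemeasurable _
  have hQm : ∀ j i, Measurable fun ω => |Q j ω i - R ω i| := fun j i =>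
    ((A.measurable_residual (f j) i).sub (A.measurable_residual g i)).abs
  -- The threshold is `γ / 2` because a comparison involves two residuals, each of which may move.
  have hpert : ∀ (j : Fin m) (a : Fin (n + 1)),
      μ.real {ω | γ / 2 < |Q j ω (f j a) - R ω (f j a)|} ≤ s := fun j a => by
    refine (A.measureReal_abs_residual_sub_residual_gt_le P (k := k) (by omega)
      (Fin.snoc_inl_inr_injective j) g a n.succ_pos hb (half_pos hγ) hstab).trans ?_
    rw [hs, div_le_div_iff₀ (half_pos hγ) hγ, hmk]
    push_cast
    nlinarith [mul_nonneg hb hγ.le]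
  set bad : Fin m → Set (Fin n ⊕ Fin m → X × ℝ) := fun j =>
    {ω | γ / 2 < |Q j ω (Sum.inr j) - R ω (Sum.inr j)|} ∪
    {ω | δ * n ≤ ((Finset.univ.filter fun i : Fin n =>
      ω ∈ {ω | γ / 2 < |Q j ω (Sum.inl i) - R ω (Sum.inl i)|}).card : ℝ)} with hbad
  have hbadm : ∀ j, MeasurableSet (bad j) := fun j => by
    refine (measurableSet_lt measurable_const (hQm j _)).union
      (measurableSet_le measurable_const ?_)
    simp only [Finset.natCast_card_filter]
    exact Finset.measurable_sum _ fun i _ => Measurable.ite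
      (measurableSet_lt measurable_const (hQm j _)) measurable_const measurable_const
  have hμbad : ∀ j, μ.real (bad j) ≤ s + s / δ := fun j => by
    refine (measureReal_union_le _ _).trans (add_le_add ?_ ?_)
    · simpa [hf] using hpert j (Fin.last n)
    · have := measureReal_card_filter_ge_le (μ := μ)
        (E := fun i : Fin n => {ω | γ / 2 < |Q j ω (Sum.inl i) - R ω (Sum.inl i)|})
        (fun i => measurableSet_lt measurable_const (hQm j _)) (p := s)
        (fun i => by simpa [hf] using hpert j i.castSucc) (c := δ * n) (by positivity)
      refine this.trans_eq ?_
      rw [Fintype.card_fin]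
      field_simp
  have hμE₃ := measureReal_card_filter_ge_le hbadm hμbad (c := δ * m) (by positivity)
  set E₃ : Set (Fin n ⊕ Fin m → X × ℝ) :=
    {ω | δ * m ≤ ((Finset.univ.filter fun j => ω ∈ bad j).card : ℝ)} with hE₃
  have hsub : {ω : Fin n ⊕ Fin m → X × ℝ | α + 3 * h + 2 * δ ≤ F fun i => ω (Sum.inl i)}
      ⊆ E₁ ∪ E₂ ∪ E₃ := by
    intro ω hω
    by_contra hcon
    simp only [Set.mem_union, not_or, hE₁, hE₂, hE₃, Set.mem_ofPred_eq, not_le] at hcon hω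
    obtain ⟨⟨h1, h2⟩, h3⟩ := hcon
    -- A miscovered test point either has high rank in the full model or is bad: for a good one,
    -- fewer than `δ * n` of the strict comparisons are lost when changing models.
    have hincl : (Finset.univ.filter fun j => ((fun i => ω (Sum.inl i)), ω (Sum.inr j)) ∈ B) ⊆
        (Finset.univ.filter fun j : Fin m => (1 - (α + δ)) * n ≤
          ((Finset.univ.filter fun i : Fin n => R ω (Sum.inl i) < R ω (Sum.inr j)).card : ℝ)) ∪
        (Finset.univ.filter fun j => ω ∈ bad j) := by
      intro j hj
      simp only [Finset.mem_union, Finset.mem_filter, Finset.mem_univ, true_and] at hj ⊢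
      by_contra! hcon
      obtain ⟨hlt, hgood⟩ := hcon
      simp only [hbad, Set.mem_union, not_or, Set.mem_ofPred_eq, not_lt, not_le] at hgood
      obtain ⟨hg1, hg2⟩ := hgood
      rw [A.mk_mem_exceedanceSet_iff] at hj
      have hcover : (Finset.univ.filter fun i : Fin n =>
            Q j ω (Sum.inl i) < Q j ω (Sum.inr j) - γ) ⊆
          (Finset.univ.filter fun i : Fin n => R ω (Sum.inl i) < R ω (Sum.inr j)) ∪
          (Finset.univ.filter fun i : Fin n => γ / 2 < |Q j ω (Sum.inl i) - R ω (Sum.inl i)|) := by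
        intro i hi
        simp only [Finset.mem_union, Finset.mem_filter, Finset.mem_univ, true_and] at hi ⊢
        by_contra! hc
        have := (abs_le.1 hc.2).1
        have := (abs_le.1 hg1).2
        linarith [hc.1]
      have hcard := (Finset.card_le_card hcover).trans (Finset.card_union_le _ _)
      rw [← Nat.cast_le (α := ℝ)] at hcard
      push_cast at hcard
      -- The finite-sample correction `1 + 1 / n` of the level only helps here.
      have : (1 - α) * n ≤ (1 - α) * (n + 1) := by nlinarith
      linarith
    have hcard := (Finset.card_le_card hincl).trans (Finset.card_union_le _ _)
    rw [← Nat.cast_le (α := ℝ)] at hcard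
    push_cast at hcard
    have : (α + 3 * h + 2 * δ) * m ≤ F (fun i => ω (Sum.inl i)) * m :=
      mul_le_mul_of_nonneg_right hω hm'.le
    linarith
  have hmp := measurePreserving_pi_comp_injective (P : Measure (X × ℝ))
    (Sum.inl_injective : Function.Injective (Sum.inl : Fin n → Fin n ⊕ Fin m))
  have hG : MeasurableSet {D : Fin n → X × ℝ | α + 3 * h + 2 * δ ≤ F D} :=
    measurableSet_le measurable_const hFm
  calc iidLaw P n {D | α + 3 * h + 2 * δ ≤ conformalMiscoverage A P α γ D}
      ≤ iidLaw P n {D | α + 3 * h + 2 * δ ≤ F D} :=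
        measure_mono fun D hD => le_trans hD (hmis D)
    _ = μ {ω | α + 3 * h + 2 * δ ≤ F fun i => ω (Sum.inl i)} :=
        (hmp.measure_preimage hG.nullMeasurableSet).symm
    _ ≤ μ (E₁ ∪ E₂ ∪ E₃) := measure_mono hsub
    _ = ENNReal.ofReal (μ.real (E₁ ∪ E₂ ∪ E₃)) := (ofReal_measureReal).symm
    _ ≤ _ := by
      refine ENNReal.ofReal_le_ofReal ?_
      have hu1 := measureReal_union_le (μ := μ) (E₁ ∪ E₂) E₃
      have hu2 := measureReal_union_le (μ := μ) E₁ E₂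
      have h3 : (Fintype.card (Fin m) : ℝ) * (s + s / δ) / (δ * m) = (s + s / δ) / δ := by
        rw [Fintype.card_fin]; field_simp
      rw [h3] at hμE₃
      have h4 : 2 / (m * h ^ 2) = 1 / (m * h ^ 2) + 1 / (m * h ^ 2) := by ring
      linarith

/-! ### Asymptotics of the slack. -/

theorem tendsto_slackSize {r : ℕ → ℝ} {b γ : ℕ → ℝ} (hr : ∀ n, r n = b n / γ n)
    (hpos : ∀ n, 0 < r n) (h0 : Tendsto r atTop (𝓝 0)) :
    Tendsto (fun n => slackSize (b n) (γ n)) atTop atTop := by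
  unfold slackSize
  refine tendsto_nat_ceil_atTop.comp ?_
  have h1 : Tendsto r atTop (𝓝[>] 0) :=
    tendsto_nhdsWithin_iff.2 ⟨h0, Eventually.of_forall hpos⟩
  have := (tendsto_rpow_neg_nhdsGT_zero (y := -(1 / 2 : ℝ)) (by norm_num)).comp h1
  simpa [Function.comp_def, hr] using this

/-- With `r = b / γ`, rounding up gives `m r ≤ r ^ (1/2) + r`. The exponent `-1/2` lets `m` grow
while `m r` still vanishes. -/
theorem tendsto_two_mul_slackSize_mul_div {b γ : ℕ → ℝ} (hb : ∀ n, 0 < b n) (hγ : ∀ n, 0 < γ n)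
    (hbγ : Tendsto (fun n => b n / γ n) atTop (𝓝 0)) :
    Tendsto (fun n => 2 * (slackSize (b n) (γ n) : ℝ) * b n / γ n) atTop (𝓝 0) := by
  have hlim : Tendsto (fun n => 2 * ((b n / γ n) ^ (1 / 2 : ℝ) + b n / γ n)) atTop (𝓝 0) := by
    have h1 := hbγ.rpow_const (p := (1 / 2 : ℝ)) (Or.inr (by norm_num))
    rw [Real.zero_rpow (by norm_num)] at h1
    simpa using (h1.add hbγ).const_mul 2
  refine squeeze_zero (fun n => ?_) (fun n => ?_) hlim
  · have := hb n; have := hγ n; positivity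
  · have hr : 0 < b n / γ n := div_pos (hb n) (hγ n)
    have hceil : (slackSize (b n) (γ n) : ℝ) ≤ (b n / γ n) ^ (-(1 / 2) : ℝ) + 1 :=
      (Nat.ceil_lt_add_one (by positivity)).le
    have hmul : (b n / γ n) ^ (-(1 / 2) : ℝ) * (b n / γ n) = (b n / γ n) ^ (1 / 2 : ℝ) := by
      rw [← Real.rpow_add_one hr.ne']; norm_num
    calc _ = 2 * ((slackSize (b n) (γ n) : ℝ) * (b n / γ n)) := by ring
      _ ≤ 2 * (((b n / γ n) ^ (-(1 / 2) : ℝ) + 1) * (b n / γ n)) := by gcongr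
      _ = _ := by rw [add_mul, hmul, one_mul]

theorem theorem5 {X : Type*} [MeasurableSpace X] (α : ℝ) (hα0 : 0 ≤ α) (hα1 : α ≤ 1)
    (b γ : ℕ → ℝ) (hb : ∀ n, 0 < b n) (hγ : ∀ n, 0 < γ n)
    (hbγ : Tendsto (fun n => b n / γ n) atTop (𝓝 0)) :
    ∃ ε : ℕ → ℝ, (∀ n, ε n = coverageSlack n (b n) (γ n)) ∧
      Tendsto ε atTop (𝓝 0) ∧
      Tendsto
        (fun n : ℕ =>
          ⨆ (A : RegressionAlgorithm X) (P : ProbabilityMeasure (X × ℝ))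
            (_ : supInSampleStability A P (n + 1) n.succ_pos ≤ ENNReal.ofReal (b n)),
            iidLaw P n {D : Fin n → X × ℝ | conformalMiscoverage A P α (γ n) D ≥ α + ε n})
        atTop (𝓝 0) := by
  set m : ℕ → ℕ := fun n => slackSize (b n) (γ n) with hm
  set δ : ℕ → ℝ := fun n => (2 * (m n : ℝ) * b n / γ n) ^ (1 / 3 : ℝ) with hδ
  set h : ℕ → ℝ := fun n => 1 / (4 * (min n (m n) : ℕ) : ℝ) ^ (1 / 4 : ℝ) with hh
  have hε : ∀ n, coverageSlack n (b n) (γ n) = 3 * h n + 2 * δ n := fun n => by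
    simp only [coverageSlack, hh, hδ, hm]; ring
  have hpos : ∀ n, 0 < b n / γ n := fun n => div_pos (hb n) (hγ n)
  have hmlim : Tendsto m atTop atTop := tendsto_slackSize (fun _ => rfl) hpos hbγ
  have hm0 : ∀ n, 0 < m n := fun n => Nat.ceil_pos.2 (Real.rpow_pos_of_pos (hpos n) _)
  have hminlim : Tendsto (fun n => ((min n (m n) : ℕ) : ℝ)) atTop atTop :=
    tendsto_natCast_atTop_atTop.comp <| tendsto_atTop.2 fun c => by
      filter_upwards [eventually_ge_atTop c, tendsto_atTop.1 hmlim c] with n h1 h2 using le_min h1 h2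
  have hδlim : Tendsto δ atTop (𝓝 0) := by
    have := (tendsto_two_mul_slackSize_mul_div hb hγ hbγ).rpow_const (p := (1 / 3 : ℝ))
      (Or.inr (by norm_num))
    rwa [Real.zero_rpow (by norm_num)] at this
  have hhlim : Tendsto h atTop (𝓝 0) :=
    ((tendsto_rpow_atTop (by norm_num)).comp
      (hminlim.const_mul_atTop (by norm_num : (0 : ℝ) < 4))).const_div_atTop 1
  -- Three Chebyshev terms contribute at most `2 / √min {n, m}` each; since `s = δ ^ 3`, the Markov
  -- term `(s + s / δ) / δ` is `δ ^ 2 + δ`.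
  have hbound : Tendsto (fun n => 6 / Real.sqrt (min n (m n) : ℕ) + (δ n ^ 2 + δ n)) atTop
      (𝓝 0) := by
    have h1 := (Real.tendsto_sqrt_atTop.comp hminlim).const_div_atTop 6
    simpa using h1.add ((hδlim.pow 2).add hδlim)
  refine ⟨fun n => coverageSlack n (b n) (γ n), fun n => rfl, ?_, ?_⟩
  · simp only [hε]
    simpa using (hhlim.const_mul 3).add (hδlim.const_mul 2)
  have hbound' := ENNReal.tendsto_ofReal hbound
  rw [ENNReal.ofReal_zero] at hbound'
  refine tendsto_of_tendsto_of_tendsto_of_le_of_le' tendsto_const_nhds hbound'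
    (Eventually.of_forall fun _ => zero_le) ?_
  filter_upwards [eventually_gt_atTop 0] with n hn
  refine iSup_le fun A => iSup_le fun P => iSup_le fun hstab => ?_
  have hb' := hb n
  have hγ' := hγ n
  have hm' : (0 : ℝ) < m n := by exact_mod_cast hm0 n
  have hn' : (0 : ℝ) < n := by exact_mod_cast hn
  have hs : 0 < 2 * (m n : ℝ) * b n / γ n := by positivity
  have hδ0 : 0 < δ n := Real.rpow_pos_of_pos hs _
  have hδ3 : 2 * (m n : ℝ) * b n / γ n = δ n ^ 3 := by
    simp only [hδ]
    rw [← Real.rpow_natCast, ← Real.rpow_mul hs.le]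
    norm_num
  have hmin : (0 : ℝ) < (min n (m n) : ℕ) := by exact_mod_cast lt_min hn (hm0 n)
  have hh0 : 0 < h n := by simp only [hh]; positivity
  have hh2 : 1 / h n ^ 2 = 2 * Real.sqrt (min n (m n) : ℕ) := by
    simp only [hh]
    rw [div_pow, one_pow, one_div_one_div, ← Real.rpow_natCast, ← Real.rpow_mul (by positivity)]
    norm_num
    rw [← Real.sqrt_eq_rpow, Real.sqrt_mul (by norm_num)]
    congr 1
    rw [show (4 : ℝ) = 2 ^ 2 by norm_num, Real.sqrt_sq (by norm_num)]
  have hterm : ∀ l : ℕ, min n (m n) ≤ l → 1 / ((l : ℝ) * h n ^ 2)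
      ≤ 2 / Real.sqrt (min n (m n) : ℕ) := fun l hl => by
    have hl' : ((min n (m n) : ℕ) : ℝ) ≤ l := by exact_mod_cast hl
    have hsq := Real.sq_sqrt hmin.le
    have hsqrt := Real.sqrt_pos.2 hmin
    calc 1 / ((l : ℝ) * h n ^ 2) = 1 / h n ^ 2 / l := by field_simp
      _ = 2 * Real.sqrt (min n (m n) : ℕ) / l := by rw [hh2]
      _ ≤ 2 * Real.sqrt (min n (m n) : ℕ) / (min n (m n) : ℕ) := by gcongr
      _ = _ := by
        rw [div_eq_div_iff hmin.ne' hsqrt.ne', mul_assoc, ← sq, hsq]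
  have key := iidLaw_conformalMiscoverage_ge_le A P hα0 hα1 hn (hm0 n) hb'.le hγ' hh0 hδ0 hstab
  simp only [ge_iff_le, hε, ← add_assoc]
  refine key.trans (ENNReal.ofReal_le_ofReal ?_)
  have h1 := hterm n (min_le_left _ _)
  have h2 := hterm (m n) (min_le_right _ _)
  have h3 : 2 / ((m n : ℝ) * h n ^ 2) = 2 * (1 / ((m n : ℝ) * h n ^ 2)) := by ring
  have h4 : 6 / Real.sqrt (min n (m n) : ℕ) = 3 * (2 / Real.sqrt (min n (m n) : ℕ)) := by ring
  have h5 : (2 * (m n : ℝ) * b n / γ n + 2 * (m n : ℝ) * b n / γ n / δ n) / δ n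
      = δ n ^ 2 + δ n := by
    rw [hδ3]; field_simp
  rw [h3, h4, h5]
  linarith
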